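/- Let $X\subset\mathbb{R}^d$ be compact and let $c:X\times X\to[0,\infty)$ be symmetric, Lipschitz continuous and satisfy $c(x,x)=0$ for all $x$. Let $\epsilon>0$, let $\varphi(p)=p\log p-p+1$ for $p\ge 0$, and let $\varphi^*(q)=\sup_{p\ge 0}\,(pq-\varphi(p))$. For finite nonnegative Borel measures, $\mathrm{KL}(\mu|\nu)=\int\varphi\left(\frac{d\mu}{d\nu}\right)d\nu$ if $\mu\ll\nu$, and $+\infty$ otherwise. Let $\mathcal{M}(X)$ and $\mathcal{M}(X\times X)$ denote the sets of finite nonnegative Borel measures on $X$ and on $X\times X$, let $m(\alpha)=\alpha(X)$, and let $\pi_1,\pi_2$ be the marginals of $\pi\in\mathcal{M}(X\times X)$. For $\alpha,\beta\in\mathcal{M}(X)$ put $$\mathrm{OT}_{\epsilon,\varphi}(\alpha,\beta)=\inf_{\pi\in\mathcal{M}(X\times X)}\int c\,d\pi+\mathrm{KL}(\pi_1|\alpha)+\mathrm{KL}(\pi_2|\beta)+\epsilon\,\mathrm{KL}(\pi|\alpha\otimes\beta);$$ the minimizers are called optimal transport plans for $(\alpha,\beta)$. A pair $(f,g)$ of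 continuous real functions on $X$ is called a pair of optimal potentials for $(\alpha,\beta)$ if it maximizes, over all such pairs, $$J_{(\alpha,\beta)}(f,g)=-\int\varphi^*(-f)\,d\alpha-\int\varphi^*(-g)\,d\beta-\epsilon\int\left(e^{(f(x)+g(y)-c(x,y))/\epsilon}-1\right)d\alpha(x)\,d\beta(y).$$ Put $$\mathrm{Sk}_{\epsilon,\varphi}(\alpha,\beta)=\mathrm{OT}_{\epsilon,\varphi}(\alpha,\beta)-\tfrac12\mathrm{OT}_{\epsilon,\varphi}(\alpha,\alpha)-\tfrac12\mathrm{OT}_{\epsilon,\varphi}(\beta,\beta)+\tfrac{\epsilon}{2}(m(\alpha)-m(\beta))^2 .$$ For $k>0$, a function $F:\mathcal{M}(X)\times\mathcal{M}(X)\to\mathbb{R}$ is $k$-homogeneous if $F(\lambda\alpha,\lambda\beta)=\lambda^kF(\alpha,\beta)$ for all $\lambda\ge 0$ and all $\alpha,\beta$. Let $h=2-\frac{2}{2+\epsilon}$. Then: 1. For all $\alpha,\beta\in\mathcal{M}(X)$ and $\lambda>0$, a pair $(f,g)$ is a pair of optimal potentials for $(\alpha,\beta)$ if and only if $\left(f-\frac{\epsilon}{2+\epsilon}\log\lambda,\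 g-\frac{\epsilon}{2+\epsilon}\log\lambda\right)$ is a pair of optimal potentials for $(\lambda\alpha,\lambda\beta)$. 2. For all $\alpha,\beta\in\mathcal{M}(X)$ and $\lambda>0$, $\pi$ is an optimal transport plan for $(\alpha,\beta)$ if and only if $\lambda^h\pi$ is an optimal transport plan for $(\lambda\alpha,\lambda\beta)$. 3. $\mathrm{Sk}_{\epsilon,\varphi}$ is $h$-homogeneous. On the other hand, $\mathrm{OT}_{\epsilon,\varphi}$ is not $h$-homogeneous: for all $\alpha,\beta\in\mathcal{M}(X)$ that are not both zero there is $\lambda>0$ with $\mathrm{OT}_{\epsilon,\varphi}(\lambda\alpha,\lambda\beta)\ne\lambda^h\,\mathrm{OT}_{\epsilon,\varphi}(\alpha,\beta)$; moreover, if $X\neq\emptyset$, then $\mathrm{OT}_{\epsilon,\varphi}$ is not $k$-homogeneous for any $k>0$. -/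

import Mathlib

open MeasureTheory
open scoped NNReal ENNReal

namespace UROT

/-- The Legendre transform `φ*(q) = sup_{p ≥ 0} (p q - φ p)` of a real-valued entropy function. -/
noncomputable def legendre (φ : ℝ → ℝ) (q : ℝ) : ℝ :=
  ⨆ p : ℝ≥0, ((p : ℝ) * q - φ p)

/-- For `φ p = p log p - p + 1` the supremum defining `φ*` is a genuine (finite) one. -/
theorem isLUB_legendre_klFun (q : ℝ) :
    IsLUB (Set.range fun p : ℝ≥0 => (p : ℝ) * q - InformationTheory.klFun p)
      (Real.exp q - 1) := by
  constructor
  · rintro _ ⟨p, rfl⟩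
    rcases eq_or_lt_of_le p.2 with hp | hp
    · have h0 : (p : ℝ) = 0 := hp.symm
      simp only [h0, InformationTheory.klFun]
      have := Real.exp_pos q
      simp
      linarith
    · have hp' : (0 : ℝ) < p := hp
      have h1 := Real.add_one_le_exp (q - Real.log p)
      rw [Real.exp_sub, Real.exp_log hp', le_div_iff₀ hp'] at h1
      simp only [InformationTheory.klFun]
      nlinarith
  · intro b hb
    have h : Real.exp q * q - InformationTheory.klFun (Real.exp q) ≤ b :=
      hb ⟨⟨Real.exp q, (Real.exp_pos q).le⟩, rfl⟩
    simp only [InformationTheory.klFun, Real.log_exp] at h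
    linarith

section

variable {X : Type*} [MeasurableSpace X]

/-- The primal objective
`⟨c, π⟩ + KL(π₁ | α) + KL(π₂ | β) + ε KL(π | α ⊗ β)`, with values in `[0, ∞]`
(the cost `c` is nonnegative). -/
noncomputable def primal (c : X → X → ℝ) (ε : ℝ) (α β : FiniteMeasure X)
    (π : FiniteMeasure (X × X)) : ℝ≥0∞ :=
  ∫⁻ z, ENNReal.ofReal (c z.1 z.2) ∂(π : Measure (X × X))
    + InformationTheory.klDiv ((π : Measure (X × X)).map Prod.fst) (α : Measure X)
    + InformationTheory.klDiv ((π : Measure (X × X)).map Prod.snd) (β : Measure X)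
    + ENNReal.ofReal ε *
      InformationTheory.klDiv (π : Measure (X × X)) ((α : Measure X).prod (β : Measure X))

/-- The infimum of the primal objective over all finite nonnegative measures on `X × X`. -/
noncomputable def otInf (c : X → X → ℝ) (ε : ℝ) (α β : FiniteMeasure X) : ℝ≥0∞ :=
  ⨅ π : FiniteMeasure (X × X), primal c ε α β π

/-- The infimum is finite, since the zero plan has finite objective. -/
theorem otInf_ne_top (c : X → X → ℝ) (ε : ℝ) (α β : FiniteMeasure X) :
    otInf c ε α β ≠ ∞ := by
  refine ne_top_of_le_ne_top ?_ (iInf_le (fun π => primal c ε α β π) 0)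
  simp [primal, InformationTheory.klDiv_zero_left, ENNReal.mul_eq_top]

/-- The unbalanced regularized transport cost `OT_{ε,φ}(α, β)` for KL marginal penalties. -/
noncomputable def OT (c : X → X → ℝ) (ε : ℝ) (α β : FiniteMeasure X) : ℝ :=
  (otInf c ε α β).toReal

/-- The unbalanced Sinkhorn divergence, including the mass bias term. -/
noncomputable def sinkhornDiv (c : X → X → ℝ) (ε : ℝ) (α β : FiniteMeasure X) : ℝ :=
  OT c ε α β - 1 / 2 * OT c ε α α - 1 / 2 * OT c ε β β
    + ε / 2 * ((α.mass : ℝ) - (β.mass : ℝ)) ^ 2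

/-- `π` minimizes the primal objective for the couple `(α, β)`. -/
def IsOptimalPlan (c : X → X → ℝ) (ε : ℝ) (α β : FiniteMeasure X)
    (π : FiniteMeasure (X × X)) : Prop :=
  ∀ π' : FiniteMeasure (X × X), primal c ε α β π ≤ primal c ε α β π'

/-- The dual objective
`⟨-φ*(-f), α⟩ + ⟨-φ*(-g), β⟩ - ε ⟨exp((f ⊕ g - c)/ε) - 1, α ⊗ β⟩`
for `φ p = p log p - p + 1`. -/
noncomputable def dual (c : X → X → ℝ) (ε : ℝ) (α β : FiniteMeasure X) (f g : X → ℝ) : ℝ :=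
  ∫ x, -legendre InformationTheory.klFun (-f x) ∂(α : Measure X)
    + ∫ y, -legendre InformationTheory.klFun (-g y) ∂(β : Measure X)
    - ε * ∫ z, (Real.exp ((f z.1 + g z.2 - c z.1 z.2) / ε) - 1)
        ∂((α : Measure X).prod (β : Measure X))

/-- `(f, g)` maximizes the dual objective over pairs of continuous functions. -/
def IsOptimalPotentials [TopologicalSpace X] (c : X → X → ℝ) (ε : ℝ) (α β : FiniteMeasure X)
    (f g : C(X, ℝ)) : Prop :=
  ∀ f' g' : C(X, ℝ), dual c ε α β f' g' ≤ dual c ε α β f g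

/-- A functional of couples of measures is `k`-homogeneous:
`F (t α, t β) = t ^ k F (α, β)` for all `t ≥ 0`. -/
def IsHomogeneousOfDegree (k : ℝ) (F : FiniteMeasure X → FiniteMeasure X → ℝ) : Prop :=
  ∀ (t : ℝ≥0) (α β : FiniteMeasure X), F (t • α) (t • β) = (t : ℝ) ^ k * F α β

end

end UROT

namespace UROT

open InformationTheory Set Filter Topology

/-! ### KL under independent rescaling of its two arguments -/

section KL

variable {Y : Type*} [MeasurableSpace Y] {μ ν : Measure Y} [IsFiniteMeasure μ] [IsFiniteMeasure ν]

/-! Scaling `π` by `s` and `α`, `β` by `t` makes each KL term affine in its old value, up to a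
logarithmic term proportional to the mass of `π`. A plan and its marginals share one mass, so these
terms cancel when `(2 + ε) log s = (2 + 2ε) log t`, that is `s = t ^ h`. The remaining correction
`(t - s)(m(α) + m(β)) + ε (t² - s) m(α) m(β)` does not depend on `π`, so minimizers correspond
(`primal_smul`) and `OT_smul` follows. Shifting the potentials yields the same affine law for the
dual (`dual_smul_sub_const`), without any duality theorem. The correction combines with the mass
bias in the Sinkhorn divergence, but obstructs homogeneity of `OT` because `1 < h < 2`. -/

theorem klDiv_smul_smul_ne_top (h : klDiv μ ν ≠ ∞) {s t : ℝ≥0} (ht : t ≠ 0) :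
    klDiv (s • μ) (t • ν) ≠ ∞ := by
  obtain ⟨hac, hint⟩ := klDiv_ne_top_iff.mp h
  rcases eq_or_ne s 0 with rfl | hs
  · rw [zero_smul, klDiv_zero_left]
    exact measure_ne_top _ _
  have hac' : μ ≪ t • ν := hac.smul_right (by simpa using ht)
  have hint' : Integrable (llr μ (t • ν)) μ := by
    rw [integrable_congr (llr_smul_nnreal_right hac t ht)]
    fun_prop
  refine klDiv_ne_top (hac'.smul_left s) (Integrable.smul_measure_nnreal ?_)
  rw [integrable_congr (llr_smul_nnreal_left hac' s hs)]
  fun_prop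

theorem toReal_klDiv_smul_smul (h : klDiv μ ν ≠ ∞) {s t : ℝ≥0} (ht : t ≠ 0) :
    (klDiv (s • μ) (t • ν)).toReal = s * (klDiv μ ν).toReal + (t - s) * ν.real univ
      + s * (Real.log s - Real.log t) * μ.real univ := by
  obtain ⟨hac, hint⟩ := klDiv_ne_top_iff.mp h
  have hac' : μ ≪ t • ν := hac.smul_right (by simpa using ht)
  have hint' : Integrable (llr μ (t • ν)) μ := by
    rw [integrable_congr (llr_smul_nnreal_right hac t ht)]
    fun_prop
  rw [toReal_klDiv_smul_left hac' hint', toReal_klDiv_smul_right hac hint ht,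
    measureReal_nnreal_smul_apply]
  ring

end KL

/-! ### Scaling of the primal problem -/

section Scaling

variable {X : Type*} [MeasurableSpace X]

theorem primal_ne_top_iff {c : X → X → ℝ} {ε : ℝ} (hε : 0 < ε) {α β : FiniteMeasure X}
    {π : FiniteMeasure (X × X)} :
    primal c ε α β π ≠ ∞ ↔
      ((∫⁻ z, ENNReal.ofReal (c z.1 z.2) ∂(π : Measure (X × X)) ≠ ∞ ∧
        klDiv ((π : Measure (X × X)).map Prod.fst) (α : Measure X) ≠ ∞) ∧
        klDiv ((π : Measure (X × X)).map Prod.snd) (β : Measure X) ≠ ∞) ∧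
        klDiv (π : Measure (X × X)) ((α : Measure X).prod (β : Measure X)) ≠ ∞ := by
  have : ENNReal.ofReal ε ≠ 0 := by simpa using hε
  simp [primal, ENNReal.add_eq_top, ENNReal.mul_eq_top, this, not_or]

theorem toMeasure_prod_smul (α β : FiniteMeasure X) (t : ℝ≥0) :
    (((t • α : FiniteMeasure X) : Measure X).prod ((t • β : FiniteMeasure X) : Measure X))
      = (t ^ 2) • ((α : Measure X).prod (β : Measure X)) := by
  rw [FiniteMeasure.toMeasure_smul, FiniteMeasure.toMeasure_smul, Measure.prod_smul_left,
    Measure.prod_smul_right, smul_smul, sq]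

theorem real_univ_eq_mass {Y : Type*} [MeasurableSpace Y] (α : FiniteMeasure Y) :
    (α : Measure Y).real univ = α.mass := rfl

theorem primal_smul_ne_top {c : X → X → ℝ} {ε : ℝ} (hε : 0 < ε) {α β : FiniteMeasure X}
    {π : FiniteMeasure (X × X)} (s : ℝ≥0) {t : ℝ≥0} (ht : t ≠ 0) (h : primal c ε α β π ≠ ∞) :
    primal c ε (t • α) (t • β) (s • π) ≠ ∞ := by
  rw [primal_ne_top_iff hε] at h ⊢
  obtain ⟨⟨⟨h1, h2⟩, h3⟩, h4⟩ := h
  rw [toMeasure_prod_smul]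
  simp only [FiniteMeasure.toMeasure_smul, Measure.map_smul, lintegral_smul_measure]
  refine ⟨⟨⟨?_, klDiv_smul_smul_ne_top h2 ht⟩, klDiv_smul_smul_ne_top h3 ht⟩,
    klDiv_smul_smul_ne_top h4 (pow_ne_zero 2 ht)⟩
  rw [ENNReal.smul_def, smul_eq_mul]
  exact ENNReal.mul_ne_top ENNReal.coe_ne_top h1

theorem toReal_primal {c : X → X → ℝ} {ε : ℝ} (hε : 0 < ε) {α β : FiniteMeasure X}
    {π : FiniteMeasure (X × X)} (h : primal c ε α β π ≠ ∞) :
    (primal c ε α β π).toReal =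
      (∫⁻ z, ENNReal.ofReal (c z.1 z.2) ∂(π : Measure (X × X))).toReal
        + (klDiv ((π : Measure (X × X)).map Prod.fst) (α : Measure X)).toReal
        + (klDiv ((π : Measure (X × X)).map Prod.snd) (β : Measure X)).toReal
        + ε * (klDiv (π : Measure (X × X)) ((α : Measure X).prod (β : Measure X))).toReal := by
  obtain ⟨⟨⟨h1, h2⟩, h3⟩, h4⟩ := (primal_ne_top_iff hε).1 h
  rw [primal, ENNReal.toReal_add (by simp [*]) (ENNReal.mul_ne_top (by simp) h4),
    ENNReal.toReal_add (by simp [*]) h3, ENNReal.toReal_add h1 h2, ENNReal.toReal_mul,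
    ENNReal.toReal_ofReal hε.le]

theorem toReal_primal_smul {c : X → X → ℝ} {ε : ℝ} (hε : 0 < ε) {α β : FiniteMeasure X}
    {π : FiniteMeasure (X × X)} {s t : ℝ≥0} (ht : t ≠ 0)
    (hst : (2 + ε) * Real.log s = (2 + 2 * ε) * Real.log t)
    (h : primal c ε α β π ≠ ∞) :
    (primal c ε (t • α) (t • β) (s • π)).toReal =
      s * (primal c ε α β π).toReal + (t - s) * (α.mass + β.mass)
        + ε * (t ^ 2 - s) * (α.mass * β.mass) := by
  rw [toReal_primal hε h, toReal_primal hε (primal_smul_ne_top hε s ht h)]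
  obtain ⟨⟨⟨h1, h2⟩, h3⟩, h4⟩ := (primal_ne_top_iff hε).1 h
  rw [toMeasure_prod_smul]
  simp only [FiniteMeasure.toMeasure_smul, Measure.map_smul, lintegral_smul_measure]
  rw [toReal_klDiv_smul_smul h2 ht, toReal_klDiv_smul_smul h3 ht,
    toReal_klDiv_smul_smul h4 (pow_ne_zero 2 ht), ENNReal.smul_def, smul_eq_mul,
    ENNReal.toReal_mul, ← univ_prod_univ, measureReal_prod_prod,
    map_measureReal_apply measurable_fst .univ, map_measureReal_apply measurable_snd .univ]
  simp only [preimage_univ, univ_prod_univ, real_univ_eq_mass, ENNReal.coe_toReal, NNReal.coe_pow,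
    Real.log_pow, Nat.cast_ofNat]
  -- The logarithms of the three KL terms add up to `s m(π) ((2 + ε) log s - (2 + 2ε) log t)`.
  linear_combination (s * π.mass : ℝ) * hst

/-- The exact scaling relation of the primal objective, with the mass corrections on both sides. -/
theorem primal_smul {c : X → X → ℝ} {ε : ℝ} (hε : 0 < ε) (α β : FiniteMeasure X)
    (π : FiniteMeasure (X × X)) {s t : ℝ≥0} (hs : s ≠ 0) (ht : t ≠ 0)
    (hst : (2 + ε) * Real.log s = (2 + 2 * ε) * Real.log t) :
    primal c ε (t • α) (t • β) (s • π)
        + ENNReal.ofReal (s * (α.mass + β.mass + ε * (α.mass * β.mass)))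
      = s * primal c ε α β π
        + ENNReal.ofReal (t * (α.mass + β.mass) + ε * t ^ 2 * (α.mass * β.mass)) := by
  by_cases h : primal c ε α β π = ∞
  · have h' : primal c ε (t • α) (t • β) (s • π) = ∞ := by
      by_contra h'
      have := primal_smul_ne_top hε s⁻¹ (inv_ne_zero ht) h'
      simp only [smul_smul, inv_mul_cancel₀ hs, inv_mul_cancel₀ ht, one_smul] at this
      exact this h
    simp [h, h', ENNReal.mul_top, hs]
  · have h' := primal_smul_ne_top hε s ht h
    have h₁ : (s : ℝ≥0∞) * primal c ε α β π ≠ ∞ := ENNReal.mul_ne_top ENNReal.coe_ne_top h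
    rw [← ENNReal.toReal_eq_toReal_iff' (ENNReal.add_ne_top.2 ⟨h', ENNReal.ofReal_ne_top⟩)
        (ENNReal.add_ne_top.2 ⟨h₁, ENNReal.ofReal_ne_top⟩),
      ENNReal.toReal_add h' ENNReal.ofReal_ne_top,
      ENNReal.toReal_add h₁ ENNReal.ofReal_ne_top,
      ENNReal.toReal_ofReal (by positivity), ENNReal.toReal_ofReal (by positivity),
      toReal_primal_smul hε ht hst h, ENNReal.toReal_mul, ENNReal.coe_toReal]
    ring

theorem isOptimalPlan_smul_iff {c : X → X → ℝ} {ε : ℝ} (hε : 0 < ε) (α β : FiniteMeasure X)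
    (π : FiniteMeasure (X × X)) {s t : ℝ≥0} (hs : s ≠ 0) (ht : t ≠ 0)
    (hst : (2 + ε) * Real.log s = (2 + 2 * ε) * Real.log t) :
    IsOptimalPlan c ε α β π ↔ IsOptimalPlan c ε (t • α) (t • β) (s • π) := by
  have hsurj : Function.Surjective fun π : FiniteMeasure (X × X) => s • π :=
    fun π => ⟨s⁻¹ • π, by simp [smul_smul, hs]⟩
  have key (π' : FiniteMeasure (X × X)) : primal c ε α β π ≤ primal c ε α β π' ↔
      primal c ε (t • α) (t • β) (s • π) ≤ primal c ε (t • α) (t • β) (s • π') := by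
    rw [← ENNReal.mul_le_mul_iff_right (a := (s : ℝ≥0∞)) (by simpa) ENNReal.coe_ne_top,
      ← ENNReal.add_le_add_iff_right ENNReal.ofReal_ne_top, ← primal_smul hε α β π hs ht hst,
      ← primal_smul hε α β π' hs ht hst, ENNReal.add_le_add_iff_right ENNReal.ofReal_ne_top]
  exact ⟨fun h => hsurj.forall.2 fun π' => (key π').1 (h π'), fun h π' => (key π').2 (h _)⟩

theorem otInf_smul {c : X → X → ℝ} {ε : ℝ} (hε : 0 < ε) (α β : FiniteMeasure X)
    {s t : ℝ≥0} (hs : s ≠ 0) (ht : t ≠ 0)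
    (hst : (2 + ε) * Real.log s = (2 + 2 * ε) * Real.log t) :
    otInf c ε (t • α) (t • β)
        + ENNReal.ofReal (s * (α.mass + β.mass + ε * (α.mass * β.mass)))
      = s * otInf c ε α β
        + ENNReal.ofReal (t * (α.mass + β.mass) + ε * t ^ 2 * (α.mass * β.mass)) := by
  have hsurj : Function.Surjective fun π : FiniteMeasure (X × X) => s • π :=
    fun π => ⟨s⁻¹ • π, by simp [smul_smul, hs]⟩
  rw [otInf, otInf, ENNReal.mul_iInf_of_ne (by simpa) ENNReal.coe_ne_top, ENNReal.iInf_add,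
    ENNReal.iInf_add, ← hsurj.iInf_comp]
  exact iInf_congr fun π => primal_smul hε α β π hs ht hst

theorem OT_smul {c : X → X → ℝ} {ε : ℝ} (hε : 0 < ε) (α β : FiniteMeasure X)
    {s t : ℝ≥0} (hs : s ≠ 0) (ht : t ≠ 0)
    (hst : (2 + ε) * Real.log s = (2 + 2 * ε) * Real.log t) :
    OT c ε (t • α) (t • β) = s * OT c ε α β
      + ((t - s) * (α.mass + β.mass) + ε * (t ^ 2 - s) * (α.mass * β.mass)) := by
  have h := congrArg ENNReal.toReal (otInf_smul (c := c) hε α β hs ht hst)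
  rw [ENNReal.toReal_add (otInf_ne_top _ _ _ _) ENNReal.ofReal_ne_top,
    ENNReal.toReal_add (ENNReal.mul_ne_top ENNReal.coe_ne_top (otInf_ne_top _ _ _ _))
      ENNReal.ofReal_ne_top,
    ENNReal.toReal_ofReal (by positivity), ENNReal.toReal_ofReal (by positivity),
    ENNReal.toReal_mul, ENNReal.coe_toReal] at h
  rw [OT, OT]
  linear_combination h

theorem mass_smul (t : ℝ≥0) (α : FiniteMeasure X) : (t • α).mass = t * α.mass := by
  simp [FiniteMeasure.mass]

/-- Since `α ⊗ 0 = 0`, only the zero plan has finite cost, and it pays the mass of `α`. -/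
theorem OT_zero_right (c : X → X → ℝ) {ε : ℝ} (hε : 0 < ε) (α : FiniteMeasure X) :
    OT c ε α 0 = α.mass := by
  have h : otInf c ε α 0 = α.mass := by
    refine le_antisymm ((iInf_le _ 0).trans_eq (by simp [primal])) (le_iInf fun π => ?_)
    rcases eq_or_ne π 0 with rfl | hπ
    · simp [primal]
    · have : NeZero (π : Measure (X × X)) :=
        ⟨fun h => hπ (FiniteMeasure.toMeasure_injective (by simpa using h))⟩
      have h' : primal c ε α 0 π = ∞ := by
        by_contra h'
        exact ((primal_ne_top_iff hε).1 h').2 (by simp)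
      simp [h']
  rw [OT, h, ENNReal.coe_toReal]

theorem legendre_klFun (q : ℝ) : legendre klFun q = Real.exp q - 1 :=
  (isLUB_legendre_klFun q).csSup_eq (range_nonempty _)

end Scaling

/-! ### Scaling of the dual problem -/

section Dual

variable {X : Type*} [MeasurableSpace X] [TopologicalSpace X] [CompactSpace X] [BorelSpace X]
  [OpensMeasurableSpace (X × X)]

/-- Isolates the mass constants from the exponential integrals, on which a constant shift of the
potentials acts by a factor. -/
theorem dual_eq {c : X → X → ℝ} (hc : Continuous fun z : X × X => c z.1 z.2) (ε : ℝ)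
    (α β : FiniteMeasure X) (f g : C(X, ℝ)) :
    dual c ε α β f g = α.mass + β.mass + ε * (α.mass * β.mass)
      - (∫ x, Real.exp (-f x) ∂(α : Measure X) + ∫ y, Real.exp (-g y) ∂(β : Measure X)
        + ε * ∫ z, Real.exp ((f z.1 + g z.2 - c z.1 z.2) / ε)
          ∂((α : Measure X).prod (β : Measure X))) := by
  have hint {Y : Type _} [MeasurableSpace Y] [TopologicalSpace Y] [CompactSpace Y]
      [OpensMeasurableSpace Y] (μ : Measure Y) [IsFiniteMeasure μ] {u : Y → ℝ}
      (hu : Continuous u) : Integrable u μ :=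
    hu.integrable_of_hasCompactSupport (HasCompactSupport.of_compactSpace u)
  simp only [dual, legendre_klFun, neg_sub]
  rw [integral_sub (integrable_const _) (hint _ (by fun_prop)),
    integral_sub (integrable_const _) (hint _ (by fun_prop)),
    integral_sub (hint _ (by fun_prop)) (integrable_const _)]
  simp only [integral_const, smul_eq_mul, mul_one]
  rw [← univ_prod_univ, measureReal_prod_prod, real_univ_eq_mass, real_univ_eq_mass]
  ring

/-- The exact scaling relation of the dual objective. -/
theorem dual_smul_sub_const {c : X → X → ℝ} (hc : Continuous fun z : X × X => c z.1 z.2) {ε : ℝ}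
    (α β : FiniteMeasure X) (f g : C(X, ℝ)) {s t : ℝ≥0} {a : ℝ}
    (h₁ : t * Real.exp a = s) (h₂ : t ^ 2 * Real.exp (-(2 * a / ε)) = s) :
    dual c ε (t • α) (t • β) ↑(f - ContinuousMap.const X a) ↑(g - ContinuousMap.const X a) =
      s * dual c ε α β f g
        + ((t - s) * (α.mass + β.mass) + ε * (t ^ 2 - s) * (α.mass * β.mass)) := by
  have hexp (u : ℝ) : Real.exp (-(u - a)) = Real.exp a * Real.exp (-u) := by
    rw [← Real.exp_add]; ring_nf
  have hexp₂ (u v w : ℝ) : Real.exp ((u - a + (v - a) - w) / ε)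
      = Real.exp (-(2 * a / ε)) * Real.exp ((u + v - w) / ε) := by
    rw [← Real.exp_add]; ring_nf
  rw [dual_eq hc, dual_eq hc, toMeasure_prod_smul, FiniteMeasure.toMeasure_smul,
    FiniteMeasure.toMeasure_smul]
  simp only [ContinuousMap.sub_apply, ContinuousMap.const_apply, hexp, hexp₂, integral_const_mul,
    integral_smul_nnreal_measure, mass_smul, NNReal.smul_def, smul_eq_mul, NNReal.coe_mul,
    NNReal.coe_pow]
  linear_combination
    -(∫ x, Real.exp (-f x) ∂(α : Measure X) + ∫ y, Real.exp (-g y) ∂(β : Measure X)) * h₁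
    - (ε * ∫ z, Real.exp ((f z.1 + g z.2 - c z.1 z.2) / ε)
          ∂((α : Measure X).prod (β : Measure X))) * h₂

theorem isOptimalPotentials_smul_iff {c : X → X → ℝ}
    (hc : Continuous fun z : X × X => c z.1 z.2) {ε : ℝ}
    (α β : FiniteMeasure X) (f g : C(X, ℝ)) {s t : ℝ≥0} {a : ℝ} (hs : s ≠ 0)
    (h₁ : t * Real.exp a = s) (h₂ : t ^ 2 * Real.exp (-(2 * a / ε)) = s) :
    IsOptimalPotentials c ε α β f g ↔ IsOptimalPotentials c ε (t • α) (t • β)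
      (f - ContinuousMap.const X a) (g - ContinuousMap.const X a) := by
  have hs' : (0 : ℝ) < s := by positivity
  have key (f' g' : C(X, ℝ)) : dual c ε α β f' g' ≤ dual c ε α β f g ↔
      dual c ε (t • α) (t • β) ↑(f' - ContinuousMap.const X a) ↑(g' - ContinuousMap.const X a) ≤
      dual c ε (t • α) (t • β) ↑(f - ContinuousMap.const X a) ↑(g - ContinuousMap.const X a) := by
    rw [dual_smul_sub_const hc α β f' g' h₁ h₂, dual_smul_sub_const hc α β f g h₁ h₂,
      add_le_add_iff_right, mul_le_mul_iff_right₀ hs']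
  refine ⟨fun h f' g' => ?_, fun h f' g' => (key f' g').2 (h _ _)⟩
  -- Every competitor of the scaled problem is a shifted pair.
  simpa using (key (f' + ContinuousMap.const X a) (g' + ContinuousMap.const X a)).1 (h _ _)

end Dual

/-! ### Homogeneity of the divergence and its failure for the cost -/

section Homogeneity

variable {X : Type*} [MeasurableSpace X]

/-- If `x t + y t² = z t ^ h` for all `t > 0`, with `h > 1`, then `x = 0`. -/
theorem eq_zero_of_forall_rpow {x y z h : ℝ} (hh : 1 < h)
    (H : ∀ t : ℝ≥0, 0 < t → x * t + y * t ^ 2 = z * (t : ℝ) ^ h) : x = 0 := by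
  -- Dividing the identity by `t` shows that this function is constantly `x` for `t > 0`.
  have h₁ : Tendsto (fun t : ℝ => z * t ^ (h - 1) - y * t) (𝓝[>] 0) (𝓝 0) := by
    have : Continuous fun t : ℝ => z * t ^ (h - 1) - y * t :=
      (continuous_const.mul (Real.continuous_rpow_const (by linarith))).sub (by fun_prop)
    have h₀ := (this.tendsto 0).mono_left (nhdsWithin_le_nhds (s := Ioi 0))
    simpa [Real.zero_rpow (by linarith : h - 1 ≠ 0)] using h₀
  refine tendsto_nhds_unique (tendsto_const_nhds.congr' ?_) h₁
  filter_upwards [self_mem_nhdsWithin] with t ht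
  have ht : 0 < t := ht
  have : x * t + y * t ^ 2 = z * t ^ h := H ⟨t, ht.le⟩ ht
  rw [Real.rpow_sub ht, Real.rpow_one]
  field_simp
  linarith

theorem log_rpow_mul {ε h : ℝ} (hε : 0 < ε) (hh : h = 2 - 2 / (2 + ε)) {t : ℝ≥0} (ht : t ≠ 0) :
    (2 + ε) * Real.log ↑(t ^ h) = (2 + 2 * ε) * Real.log t := by
  rw [NNReal.coe_rpow, Real.log_rpow (by positivity), hh]
  field_simp
  ring

theorem OT_rpow_smul {c : X → X → ℝ} {ε h : ℝ} (hε : 0 < ε) (hh : h = 2 - 2 / (2 + ε))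
    (α β : FiniteMeasure X) {t : ℝ≥0} (ht : t ≠ 0) :
    OT c ε (t • α) (t • β) = (t : ℝ) ^ h * OT c ε α β
      + ((t - (t : ℝ) ^ h) * (α.mass + β.mass)
        + ε * (t ^ 2 - (t : ℝ) ^ h) * (α.mass * β.mass)) := by
  have := OT_smul (c := c) hε α β (NNReal.rpow_pos (pos_of_ne_zero ht)).ne' ht (log_rpow_mul hε hh ht)
  simpa only [NNReal.coe_rpow] using this

/-- The linear mass corrections cancel; the quadratic ones sum to `-(ε/2)(t² - t ^ h)(m(α) -
m(β))²`, which turns the factor `t²` of the bias term into `t ^ h`. -/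
theorem sinkhornDiv_isHomogeneous {c : X → X → ℝ} {ε h : ℝ} (hε : 0 < ε)
    (hh : h = 2 - 2 / (2 + ε)) (h1 : 1 < h) :
    IsHomogeneousOfDegree h fun α β : FiniteMeasure X => sinkhornDiv c ε α β := by
  intro t α β
  rcases eq_or_ne t 0 with rfl | ht
  · simp [sinkhornDiv, OT_zero_right c hε, Real.zero_rpow (by linarith : h ≠ 0)]
  · simp only [sinkhornDiv, OT_rpow_smul hε hh _ _ ht, mass_smul, NNReal.coe_mul]
    ring

theorem exists_OT_smul_ne {c : X → X → ℝ} {ε h : ℝ} (hε : 0 < ε)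
    (hh : h = 2 - 2 / (2 + ε)) (h1 : 1 < h) (α β : FiniteMeasure X) (hαβ : α ≠ 0 ∨ β ≠ 0) :
    ∃ t : ℝ≥0, 0 < t ∧ OT c ε (t • α) (t • β) ≠ (t : ℝ) ^ h * OT c ε α β := by
  by_contra! H
  have h0 : (α.mass + β.mass : ℝ) = 0 := by
    -- Homogeneity would make the correction vanish for every `t > 0`; `z` collects its `t ^ h`
    -- coefficient.
    refine eq_zero_of_forall_rpow h1 (y := ε * (α.mass * β.mass))
      (z := α.mass + β.mass + ε * (α.mass * β.mass)) fun t ht => ?_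
    have := H t ht
    rw [OT_rpow_smul hε hh α β ht.ne'] at this
    linear_combination this
  rw [add_eq_zero_iff_of_nonneg (by positivity) (by positivity)] at h0
  simp only [NNReal.coe_eq_zero, FiniteMeasure.mass_zero_iff] at h0
  tauto

theorem OT_not_isHomogeneous [Nonempty X] {c : X → X → ℝ} {ε h : ℝ} (hε : 0 < ε)
    (hh : h = 2 - 2 / (2 + ε)) (h1 : 1 < h) (h2 : h < 2) (k : ℝ) :
    ¬ IsHomogeneousOfDegree k fun α β : FiniteMeasure X => OT c ε α β := by
  intro H
  obtain ⟨x⟩ := ‹Nonempty X›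
  let δ : FiniteMeasure X := ⟨Measure.dirac x, inferInstance⟩
  have hδ : δ.mass = 1 := by simp [FiniteMeasure.mass, δ]
  -- On `(δ, 0)` the cost is the mass, so doubling gives `2 ^ k = 2`.
  have hk : k = 1 := by
    have := H 2 δ 0
    simp only [smul_zero, OT_zero_right c hε, mass_smul, hδ] at this
    norm_num at this
    rw [← Real.rpow_right_inj (x := 2) (by norm_num) (by norm_num), ← this, Real.rpow_one]
  subst hk
  have key (t : ℝ≥0) (ht : 0 < t) : (OT c ε δ δ - 2) * t + (-ε) * t ^ 2
      = (OT c ε δ δ - 2 - ε) * (t : ℝ) ^ h := by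
    have := H t δ δ
    simp only [OT_rpow_smul hε hh _ _ ht.ne', hδ, Real.rpow_one, NNReal.coe_one] at this
    linear_combination -this
  have hV := eq_zero_of_forall_rpow h1 key
  -- With `OT(δ, δ) = 2`, taking `t = 2` leaves `4ε = 2 ^ h ε`, impossible for `h < 2`.
  have := key 2 (by norm_num)
  rw [hV] at this
  have h3 : (2 : ℝ) ^ h < 2 ^ (2 : ℝ) := Real.rpow_lt_rpow_of_exponent_lt (by norm_num) h2
  norm_num at this h3
  rcases this with h | h <;> linarith

end Homogeneity

end UROT

theorem mainTheorem6 {d : ℕ} (X : Set (EuclideanSpace ℝ (Fin d))) (hX : IsCompact X)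
    (c : X → X → ℝ) (hc_nonneg : ∀ x y, 0 ≤ c x y) (hc_diag : ∀ x, c x x = 0)
    (hc_symm : ∀ x y, c x y = c y x)
    (hc_lip : ∃ K : ℝ≥0, LipschitzWith K (fun z : X × X => c z.1 z.2))
    (ε : ℝ) (hε : 0 < ε) (h : ℝ) (hh : h = 2 - 2 / (2 + ε)) :
    -- optimal potentials
    (∀ (α β : FiniteMeasure X) (t : ℝ≥0), 0 < t → ∀ f g : C(X, ℝ),
      (UROT.IsOptimalPotentials c ε α β f g ↔
        UROT.IsOptimalPotentials c ε (t • α) (t • β)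
          (f - ContinuousMap.const X (ε / (2 + ε) * Real.log t))
          (g - ContinuousMap.const X (ε / (2 + ε) * Real.log t)))) ∧
    -- optimal plans
    (∀ (α β : FiniteMeasure X) (t : ℝ≥0), 0 < t → ∀ π : FiniteMeasure (X × X),
      (UROT.IsOptimalPlan c ε α β π ↔
        UROT.IsOptimalPlan c ε (t • α) (t • β) (t ^ h • π))) ∧
    -- the Sinkhorn divergence
    UROT.IsHomogeneousOfDegree h (fun α β : FiniteMeasure X => UROT.sinkhornDiv c ε α β) ∧
    -- the transport cost, along the ray of each nonzero couple and as a functional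
    (∀ α β : FiniteMeasure X, α ≠ 0 ∨ β ≠ 0 →
      ∃ t : ℝ≥0, 0 < t ∧ UROT.OT c ε (t • α) (t • β) ≠ (t : ℝ) ^ h * UROT.OT c ε α β) ∧
    (X.Nonempty → ∀ k : ℝ, 0 < k →
      ¬ UROT.IsHomogeneousOfDegree k (fun α β : FiniteMeasure X => UROT.OT c ε α β)) := by
  have hε2 : 0 < 2 + ε := by linarith
  have h1 : 1 < h := by
    have : 2 / (2 + ε) < 1 := by rw [div_lt_one hε2]; linarith
    linarith
  have h2 : h < 2 := by
    have : 0 < 2 / (2 + ε) := by positivity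
    linarith
  have : CompactSpace X := isCompact_iff_compactSpace.mp hX
  obtain ⟨K, hK⟩ := hc_lip
  refine ⟨fun α β t ht f g => ?_, fun α β t ht π => ?_, UROT.sinkhornDiv_isHomogeneous hε hh h1,
    UROT.exists_OT_smul_ne hε hh h1, fun hne k _ => ?_⟩
  · have ht' : (0 : ℝ) < t := ht
    have hs : t ^ h ≠ 0 := (NNReal.rpow_pos ht).ne'
    -- Both conditions reduce to exponents of `t`: `1 + ε/(2 + ε) = h` and `2 - 2/(2 + ε) = h`.
    refine UROT.isOptimalPotentials_smul_iff hK.continuous α β f g hs ?_ ?_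
    · nth_rewrite 1 [← Real.exp_log ht']
      rw [NNReal.coe_rpow, Real.rpow_def_of_pos ht', ← Real.exp_add, hh]
      congr 1
      field_simp
      ring
    · nth_rewrite 1 [← Real.exp_log ht']
      rw [NNReal.coe_rpow, Real.rpow_def_of_pos ht', ← Real.exp_nat_mul, ← Real.exp_add, hh]
      congr 1
      push_cast
      field_simp
      ring
  · exact UROT.isOptimalPlan_smul_iff hε α β π (NNReal.rpow_pos ht).ne' ht.ne'
      (UROT.log_rpow_mul hε hh ht.ne')
  · have := hne.to_subtype
    exact UROT.OT_not_isHomogeneous hε hh h1 h2 k
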